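/- Consider the plant $\dot x = Ax+Bu+B_w w$, $z = Cx+Du$ with real matrices, where $(A,B)$ is stabilizable, $(C,A)$ is observable, $C^\top D=0$ and $D^\top D$ is invertible. For $K\in\mathbb R^{m\times n}$ let $\mathcal S_K$ be the closed-loop system under $u=Kx$, from $w$ to $z$: $\dot x=(A+BK)x+B_w w$, $z=(C+DK)x$. It is called stable if all eigenvalues of $A+BK$ have negative real part. If $\mathcal S_K$ is stable and $0<\alpha<-2r_K$, where $r_K$ is the largest real part of an eigenvalue of $A+BK$, its $\varepsilon(\alpha)$-norm is defined as $\|\mathcal S_K\|_{\varepsilon(\alpha)}=\sqrt{\operatorname{tr}(B_w^\top Q_{K} B_w)}$, where $Q_{K}$ is the positive definite solution of $Q_K(A+BK)+(A+BK)^\top Q_K+\alpha Q_K+\alpha^{-1}(C+DK)^\top(C+DK)=0$. Theorem. Let $\alpha>0$ and let $Q_\alpha$ be a positive definite solution of $$Q_\alpha A+A^\top Q_\alpha+\alpha Q_\alpha-\alpha Q_\alpha B(D^\top D)^{-1}B^\top Q_\alpha+\alpha^{-1}C^\top C=0.$$ Put $K_\alpha=-\alpha(D^\top D)^{-1}B^\top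 Q_\alpha$. Then $\mathcal S_{K_\alpha}$ is stable, its $\varepsilon(\alpha)$-norm is defined (that is, $\alpha<-2r_{K_\alpha}$), $$\|\mathcal S_{K_\alpha}\|_{\varepsilon(\alpha)}=\sqrt{\operatorname{tr}(B_w^\top Q_\alpha B_w)},$$ and $\|\mathcal S_{K_\alpha}\|_{\varepsilon(\alpha)}\le\|\mathcal S_K\|_{\varepsilon(\alpha)}$ for every $K\in\mathbb R^{m\times n}$ such that $\mathcal S_K$ is stable and $\alpha<-2r_K$. -/

import Mathlib

open Matrix

noncomputable section

/-- All eigenvalues of the real square matrix `A` lie in the open left half-plane. -/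
def IsStableMatrix {n : ℕ} (A : Matrix (Fin n) (Fin n) ℝ) : Prop :=
  ∀ μ ∈ spectrum ℂ (A.map ((↑) : ℝ → ℂ)), μ.re < 0

/-- `(A, B)` is stabilizable: some state feedback `u = K x` makes `A + B K` stable. -/
def IsStabilizable {n m : ℕ} (A : Matrix (Fin n) (Fin n) ℝ) (B : Matrix (Fin n) (Fin m) ℝ) :
    Prop :=
  ∃ K : Matrix (Fin m) (Fin n) ℝ, IsStableMatrix (A + B * K)

/-- `(C, A)` is observable: only the zero initial state produces the identically zero output of
`x' = A x`, `y = C x`. -/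
def IsObservablePair {n k : ℕ} (C : Matrix (Fin k) (Fin n) ℝ) (A : Matrix (Fin n) (Fin n) ℝ) :
    Prop :=
  ∀ x : ℝ → Fin n → ℝ,
    (∀ t : ℝ, 0 ≤ t → HasDerivWithinAt x (A *ᵥ x t) (Set.Ici 0) t) →
    (∀ t : ℝ, 0 ≤ t → C *ᵥ x t = 0) → x 0 = 0

/-- The linear time-invariant system `x' = A x + B u`, `y = C x` with `n` states, `m` inputs and
`k` outputs. -/
structure LTISystem (n m k : ℕ) where
  A : Matrix (Fin n) (Fin n) ℝ
  B : Matrix (Fin n) (Fin m) ℝ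
  C : Matrix (Fin k) (Fin n) ℝ

namespace LTISystem

variable {n m k : ℕ}

/-- The system is stable: its state matrix is. -/
def IsStable (S : LTISystem n m k) : Prop := IsStableMatrix S.A

/-- `α` lies in the interval `(0, -2 r)` on which the `ε(α)`-norm is defined, where `r` is the
largest real part of an eigenvalue of `A`. -/
def EpsDomain (S : LTISystem n m k) (α : ℝ) : Prop :=
  0 < α ∧ ∀ μ ∈ spectrum ℂ (S.A.map ((↑) : ℝ → ℂ)), α < -2 * μ.re

/-- Reachability equation `A P + P Aᵀ + α P + α⁻¹ B Bᵀ = 0`. -/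
def ReachEq (S : LTISystem n m k) (α : ℝ) (P : Matrix (Fin n) (Fin n) ℝ) : Prop :=
  S.A * P + P * S.Aᵀ + α • P + α⁻¹ • (S.B * S.Bᵀ) = 0

/-- Observability equation `Q A + Aᵀ Q + α Q + α⁻¹ Cᵀ C = 0`. -/
def ObsEq (S : LTISystem n m k) (α : ℝ) (Q : Matrix (Fin n) (Fin n) ℝ) : Prop :=
  Q * S.A + S.Aᵀ * Q + α • Q + α⁻¹ • (S.Cᵀ * S.C) = 0

open Classical in
/-- The positive definite solution `Q_α` of the observability equation (which exists and is unique
for an observable system and `α` in `EpsDomain`; the value `0` is a default otherwise). -/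
def obsSolution (S : LTISystem n m k) (α : ℝ) : Matrix (Fin n) (Fin n) ℝ :=
  if h : ∃ Q : Matrix (Fin n) (Fin n) ℝ, Q.PosDef ∧ S.ObsEq α Q then h.choose else 0

/-- The `ε(α)`-norm `√(trace (Bᵀ Q_α B))` of a system. -/
def epsNorm (S : LTISystem n m k) (α : ℝ) : ℝ :=
  √(trace (S.Bᵀ * S.obsSolution α * S.B))

/-- The two traces that define the square of the `ε(α)`-norm coincide. -/
theorem trace_duality (S : LTISystem n m k) {α : ℝ} (hα : 0 < α)
    {P Q : Matrix (Fin n) (Fin n) ℝ} (hP : S.ReachEq α P) (hQ : S.ObsEq α Q) :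
    trace (S.C * P * S.Cᵀ) = trace (S.Bᵀ * Q * S.B) := by
  have h1 := congrArg (fun M => trace (Q * M)) hP
  have h2 := congrArg (fun M => trace (M * P)) hQ
  simp only [Matrix.mul_add, Matrix.add_mul, trace_add, Matrix.mul_smul, Matrix.smul_mul,
    trace_smul, Matrix.mul_zero, Matrix.zero_mul, trace_zero, smul_eq_mul] at h1 h2
  have e1 : trace (Q * (P * S.Aᵀ)) = trace (S.Aᵀ * Q * P) := by
    rw [← Matrix.mul_assoc, trace_mul_comm, Matrix.mul_assoc]
  have e2 : trace (Q * (S.A * P)) = trace (Q * S.A * P) := by rw [Matrix.mul_assoc]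
  have e3 : trace (Q * (S.B * S.Bᵀ)) = trace (S.Bᵀ * Q * S.B) := by
    rw [← Matrix.mul_assoc, trace_mul_comm, Matrix.mul_assoc]
  have e4 : trace (S.Cᵀ * S.C * P) = trace (S.C * P * S.Cᵀ) := by
    rw [Matrix.mul_assoc, trace_mul_comm]
  rw [e1, e2, e3] at h1
  rw [e4] at h2
  have h3 : α⁻¹ * trace (S.C * P * S.Cᵀ) = α⁻¹ * trace (S.Bᵀ * Q * S.B) := by linarith
  exact mul_left_cancel₀ (inv_ne_zero hα.ne') h3

/-- The `ε(α)`-norm in terms of the reachability equation. -/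
theorem epsNorm_eq_reach (S : LTISystem n m k) {α : ℝ} (hα : 0 < α)
    (h : ∃ Q : Matrix (Fin n) (Fin n) ℝ, Q.PosDef ∧ S.ObsEq α Q)
    {P : Matrix (Fin n) (Fin n) ℝ} (hP : S.ReachEq α P) :
    S.epsNorm α = √(trace (S.C * P * S.Cᵀ)) := by
  have hQ : S.ObsEq α (S.obsSolution α) := by
    unfold obsSolution
    rw [dif_pos h]
    exact h.choose_spec.2
  rw [epsNorm, S.trace_duality hα hP hQ]

end LTISystem

/-- The plant `x' = A x + B u + B_w w`, `z = C x + D u` with state `x`, control `u`, disturbance `w`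
and regulated output `z` in dimensions `n`, `m`, `l`, `k`. -/
structure ControlPlant (n m l k : ℕ) where
  A : Matrix (Fin n) (Fin n) ℝ
  B : Matrix (Fin n) (Fin m) ℝ
  Bw : Matrix (Fin n) (Fin l) ℝ
  C : Matrix (Fin k) (Fin n) ℝ
  D : Matrix (Fin k) (Fin m) ℝ

namespace ControlPlant

variable {n m l k : ℕ}

/-- The closed loop under `u = K x`, from `w` to `z`:
`x' = (A + B K) x + B_w w`, `z = (C + D K) x`. -/
def closedLoop (S : ControlPlant n m l k) (K : Matrix (Fin m) (Fin n) ℝ) : LTISystem n l k where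
  A := S.A + S.B * K
  B := S.Bw
  C := S.C + S.D * K

/-- The Riccati equation `Q A + Aᵀ Q + α Q - α Q B (Dᵀ D)⁻¹ Bᵀ Q + α⁻¹ Cᵀ C = 0`. -/
def RiccatiEq (S : ControlPlant n m l k) (α : ℝ) (Q : Matrix (Fin n) (Fin n) ℝ) : Prop :=
  Q * S.A + S.Aᵀ * Q + α • Q - α • (Q * S.B * (S.Dᵀ * S.D)⁻¹ * S.Bᵀ * Q)
    + α⁻¹ • (S.Cᵀ * S.C) = 0

/-- The gain `K = -α (Dᵀ D)⁻¹ Bᵀ Q`. -/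
def riccatiGain (S : ControlPlant n m l k) (α : ℝ) (Q : Matrix (Fin n) (Fin n) ℝ) :
    Matrix (Fin m) (Fin n) ℝ :=
  -(α • ((S.Dᵀ * S.D)⁻¹ * S.Bᵀ * Q))

end ControlPlant

end

/-! Everything rests on completing the square. For any gain `K`, the Riccati solution `Q` satisfies
the closed-loop observability equation up to the residual `α⁻¹ Lᵀ L`, where `L = D (K - K_α)`
(`RiccatiEq.closedLoop_residual`). At `K = K_α` the residual vanishes, so `Q` is an observability
solution there. A Hautus-type eigenvector argument (`epsDomain_of_obsEq`) then yields stability with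
margin `α / 2`. For an admissible `K` with observability solution `X`, subtraction shows that `X -
Q` solves a Lyapunov equation for `A + B K + (α / 2) 1`, which is stable, with source `α⁻¹ Lᵀ L ≥
0`. Hence `X - Q ≥ 0`, and the trace is monotone. The Lyapunov facts are obtained without matrix
exponentials: the Cayley transform `M = (1 + F)(1 - F)⁻¹` of a stable `F` has powers tending to
zero. -/

/-! ### Lyapunov equations of stable matrices -/

open Filter Topology in
theorem tendsto_pow_zero_of_spectrum_norm_lt_one {R : Type*} [NormedRing R] [NormedAlgebra ℂ R]
    [CompleteSpace R] (a : R) (h : ∀ z ∈ spectrum ℂ a, ‖z‖ < 1) :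
    Tendsto (fun j : ℕ => a ^ j) atTop (𝓝 0) := by
  cases subsingleton_or_nontrivial R with
  | inl hs =>
    exact tendsto_const_nhds.congr fun j => Subsingleton.elim _ _
  | inr hs =>
    have h1 : spectralRadius ℂ a < ((1 : NNReal) : ENNReal) :=
      spectrum.spectralRadius_lt_of_forall_lt a fun z hz => by exact_mod_cast h z hz
    obtain ⟨r, hr1, hr2⟩ := ENNReal.lt_iff_exists_nnreal_btwn.1 h1
    have hr : (r : ℝ) < 1 := by exact_mod_cast hr2
    -- Gelfand's formula: eventually `‖a ^ j‖ ≤ r ^ j` with `r < 1`.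
    have h2 := (spectrum.pow_nnnorm_pow_one_div_tendsto_nhds_spectralRadius a).eventually_lt_const
      hr1
    refine squeeze_zero_norm' ?_ (tendsto_pow_atTop_nhds_zero_of_lt_one r.2 hr)
    filter_upwards [h2, eventually_gt_atTop 0] with j hj hj0
    have hj' : (j : ℝ) ≠ 0 := by positivity
    have h3 := ENNReal.rpow_le_rpow hj.le (Nat.cast_nonneg (α := ℝ) j)
    rw [← ENNReal.rpow_mul, one_div_mul_cancel hj', ENNReal.rpow_one, ENNReal.rpow_natCast] at h3
    exact_mod_cast h3

namespace IsStableMatrix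

variable {n : ℕ} {F : Matrix (Fin n) (Fin n) ℝ}

theorem isUnit_algebraMap_sub (hF : IsStableMatrix F) {μ : ℂ} (hμ : 0 ≤ μ.re) :
    IsUnit (algebraMap ℂ (Matrix (Fin n) (Fin n) ℂ) μ - F.map ((↑) : ℝ → ℂ)) := by
  by_contra h
  exact absurd (hF μ h) (not_lt.2 hμ)

theorem isUnit_one_sub (hF : IsStableMatrix F) : IsUnit (1 - F) := by
  have h := hF.isUnit_algebraMap_sub (μ := 1) (by simp)
  have e : algebraMap ℂ (Matrix (Fin n) (Fin n) ℂ) 1 - F.map ((↑) : ℝ → ℂ)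
      = Complex.ofRealHom.mapMatrix (1 - F) := by
    rw [map_sub, map_one, map_one]; rfl
  rw [e, isUnit_iff_isUnit_det, ← RingHom.map_det, isUnit_iff_ne_zero] at h
  rw [isUnit_iff_isUnit_det, isUnit_iff_ne_zero]
  exact fun h0 => h (by rw [h0, map_zero])

/-- An eigenvalue `z ≠ -1` of `M` comes from the eigenvalue `(z - 1) / (z + 1)` of `F`, whose real
part has the sign of `|z|² - 1`. The value `z = -1` would require `-2 • 1` to be singular. -/
theorem norm_lt_one_of_mem_spectrum_cayley (hF : IsStableMatrix F) {M : Matrix (Fin n) (Fin n) ℂ}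
    (hM : M * (1 - F.map ((↑) : ℝ → ℂ)) = 1 + F.map ((↑) : ℝ → ℂ)) {z : ℂ}
    (hz : z ∈ spectrum ℂ M) : ‖z‖ < 1 := by
  by_contra! hz1
  set E := F.map ((↑) : ℝ → ℂ)
  have key : (algebraMap ℂ _ z - M) * (1 - E) = (z - 1) • 1 - (z + 1) • E := by
    rw [sub_mul, hM, Algebra.algebraMap_eq_smul_one, smul_mul_assoc, one_mul]
    module
  suffices h : IsUnit ((algebraMap ℂ _ z - M) * (1 - E)) by
    refine hz ?_
    rw [spectrum.mem_resolventSet_iff, isUnit_iff_isUnit_det]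
    rw [isUnit_iff_isUnit_det, det_mul] at h
    exact isUnit_of_mul_isUnit_left h
  rw [key]
  by_cases h1 : z + 1 = 0
  · have hz0 : z = -1 := eq_neg_of_add_eq_zero_left h1
    rw [h1, zero_smul, sub_zero, ← Algebra.algebraMap_eq_smul_one]
    refine IsUnit.map _ (isUnit_iff_ne_zero.2 ?_)
    rw [hz0]; norm_num
  · have e : (z - 1) • (1 : Matrix (Fin n) (Fin n) ℂ) - (z + 1) • E
        = algebraMap ℂ _ (z + 1) * (algebraMap ℂ _ ((z - 1) / (z + 1)) - E) := by
      rw [Algebra.algebraMap_eq_smul_one, Algebra.algebraMap_eq_smul_one, smul_mul_assoc, one_mul,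
        smul_sub, smul_smul, mul_div_cancel₀ _ h1]
    rw [e]
    refine (IsUnit.map _ (isUnit_iff_ne_zero.2 h1)).mul (hF.isUnit_algebraMap_sub ?_)
    have h2 : 1 ≤ Complex.normSq z := by
      rw [Complex.normSq_eq_norm_sq]; nlinarith
    rw [Complex.div_re, ← add_div]
    refine div_nonneg ?_ (Complex.normSq_nonneg _)
    rw [Complex.normSq_apply] at h2
    simp
    nlinarith

open Filter Topology in
attribute [local instance] Matrix.linftyOpNormedRing Matrix.linftyOpNormedAlgebra in
/-- The Cayley transform of a stable matrix is power convergent to zero. -/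
theorem exists_cayley (hF : IsStableMatrix F) :
    ∃ G M : Matrix (Fin n) (Fin n) ℝ, (1 - F) * G = 1 ∧ M = (1 + F) * G ∧
      Tendsto (fun j : ℕ => M ^ j) atTop (𝓝 0) := by
  obtain ⟨G, hG, hG'⟩ := isUnit_iff_exists.1 hF.isUnit_one_sub
  refine ⟨G, _, hG, rfl, ?_⟩
  have hM : Complex.ofRealHom.mapMatrix ((1 + F) * G) * (1 - F.map ((↑) : ℝ → ℂ))
      = 1 + F.map ((↑) : ℝ → ℂ) := by
    have := congrArg Complex.ofRealHom.mapMatrix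
      (show (1 + F) * G * (1 - F) = 1 + F by rw [mul_assoc, hG', mul_one])
    rw [map_mul, map_sub, map_add, map_one] at this
    exact this
  have h := tendsto_pow_zero_of_spectrum_norm_lt_one _
    fun z hz => hF.norm_lt_one_of_mem_spectrum_cayley hM hz
  refine tendsto_pi_nhds.2 fun i => tendsto_pi_nhds.2 fun j => ?_
  have h2 := Complex.continuous_re.continuousAt.tendsto.comp
    (tendsto_pi_nhds.1 (tendsto_pi_nhds.1 h i) j)
  refine h2.congr fun p => ?_
  rw [Function.comp_apply, ← map_pow]
  simp

/-- The Cayley transform turns a Lyapunov equation into a Stein equation. -/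
theorem stein_of_lyapunov {G M X N : Matrix (Fin n) (Fin n) ℝ} (hG : (1 - F) * G = 1)
    (hM : M = (1 + F) * G) (hX : X * F + Fᵀ * X + N = 0) :
    X = Mᵀ * X * M + (2 : ℝ) • (Gᵀ * N * G) := by
  have h1 : X = Gᵀ * ((1 - F)ᵀ * X * (1 - F)) * G := by
    have : Gᵀ * (1 - F)ᵀ = 1 := by rw [← transpose_mul, hG, transpose_one]
    calc X = (Gᵀ * (1 - F)ᵀ) * X * ((1 - F) * G) := by rw [this, hG, one_mul, mul_one]
      _ = _ := by simp only [mul_assoc]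
  have h2 : Mᵀ * X * M = Gᵀ * ((1 + F)ᵀ * X * (1 + F)) * G := by
    rw [hM, transpose_mul]; simp only [mul_assoc]
  have h3 : (1 - F)ᵀ * X * (1 - F) = (1 + F)ᵀ * X * (1 + F) + (2 : ℝ) • N := by
    rw [eq_neg_of_add_eq_zero_right hX]
    simp only [transpose_sub, transpose_add, transpose_one, sub_mul, mul_sub, add_mul, mul_add,
      one_mul, mul_one]
    module
  rw [h2]
  nth_rw 1 [h1]
  rw [h3, mul_add, add_mul, mul_smul_comm, smul_mul_assoc]

open Filter Topology in
/-- The quadratic form of a solution of the Lyapunov equation of a stable matrix is nonnegative. -/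
theorem dotProduct_mulVec_nonneg_of_lyapunov (hF : IsStableMatrix F)
    {X : Matrix (Fin n) (Fin n) ℝ} {N : Matrix (Fin n) (Fin n) ℝ}
    (hN : ∀ x, 0 ≤ x ⬝ᵥ N *ᵥ x) (hX : X * F + Fᵀ * X + N = 0) (x : Fin n → ℝ) :
    0 ≤ x ⬝ᵥ X *ᵥ x := by
  obtain ⟨G, M, hG, hM, hlim⟩ := hF.exists_cayley
  have hstein := stein_of_lyapunov hG hM hX
  have hstep : ∀ y : Fin n → ℝ, (M *ᵥ y) ⬝ᵥ X *ᵥ (M *ᵥ y) ≤ y ⬝ᵥ X *ᵥ y := by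
    intro y
    have h := congrArg (fun Z => y ⬝ᵥ Z *ᵥ y) hstein
    have e : ∀ P Z : Matrix (Fin n) (Fin n) ℝ,
        y ⬝ᵥ (Pᵀ * Z * P) *ᵥ y = (P *ᵥ y) ⬝ᵥ Z *ᵥ (P *ᵥ y) := fun P Z => by
      rw [← mulVec_mulVec, ← mulVec_mulVec, dotProduct_mulVec, vecMul_transpose]
    simp only [add_mulVec, dotProduct_add, smul_mulVec, dotProduct_smul, e, smul_eq_mul] at h
    have := hN (G *ᵥ y)
    linarith
  -- The form does not increase along the orbit of `M` and tends to zero, so it starts nonnegative.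
  have hpow : ∀ j : ℕ, (M ^ j *ᵥ x) ⬝ᵥ X *ᵥ (M ^ j *ᵥ x) ≤ x ⬝ᵥ X *ᵥ x := by
    intro j
    induction j with
    | zero => simp
    | succ j ih =>
      rw [pow_succ', ← mulVec_mulVec]
      exact (hstep _).trans ih
  have hc : Continuous fun Z : Matrix (Fin n) (Fin n) ℝ => (Z *ᵥ x) ⬝ᵥ X *ᵥ (Z *ᵥ x) := by
    fun_prop
  have hl := (hc.tendsto 0).comp hlim
  simp only [zero_mulVec, mulVec_zero, dotProduct_zero] at hl
  exact le_of_tendsto' hl hpow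

-- Iterating `X = Mᵀ X M` writes `X` as `(M ^ j)ᵀ X M ^ j`, which tends to zero.
open Filter Topology in
theorem eq_zero_of_lyapunov (hF : IsStableMatrix F) {X : Matrix (Fin n) (Fin n) ℝ}
    (hX : X * F + Fᵀ * X = 0) : X = 0 := by
  obtain ⟨G, M, hG, hM, hlim⟩ := hF.exists_cayley
  have hstein : X = Mᵀ * X * M := by
    simpa using stein_of_lyapunov hG hM (N := 0) (by rw [hX, add_zero])
  have hpow : ∀ j : ℕ, X = (M ^ j)ᵀ * X * M ^ j := by
    intro j
    induction j with
    | zero => simp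
    | succ j ih =>
      calc X = Mᵀ * ((M ^ j)ᵀ * X * M ^ j) * M := by rw [← ih, ← hstein]
        _ = (M ^ (j + 1))ᵀ * X * M ^ (j + 1) := by
          rw [pow_succ, transpose_mul]; simp only [mul_assoc]
  have hc : Continuous fun Z : Matrix (Fin n) (Fin n) ℝ => Zᵀ * X * Z := by fun_prop
  have hl := (hc.tendsto 0).comp hlim
  rw [mul_zero] at hl
  exact tendsto_nhds_unique (tendsto_const_nhds.congr hpow) hl

/-- The Lyapunov equation of a stable matrix with a symmetric right-hand side has a symmetric
solution. -/
theorem exists_lyapunov_solution (hF : IsStableMatrix F) {N : Matrix (Fin n) (Fin n) ℝ}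
    (hN : Nᵀ = N) : ∃ X : Matrix (Fin n) (Fin n) ℝ, Xᵀ = X ∧ X * F + Fᵀ * X + N = 0 := by
  let T : Matrix (Fin n) (Fin n) ℝ →ₗ[ℝ] Matrix (Fin n) (Fin n) ℝ :=
    LinearMap.mulRight ℝ F + LinearMap.mulLeft ℝ Fᵀ
  have hT : ∀ X, T X = X * F + Fᵀ * X := fun X => rfl
  have hinj : Function.Injective T :=
    (injective_iff_map_eq_zero T).2 fun X hX => hF.eq_zero_of_lyapunov hX
  -- In finite dimension uniqueness gives existence; it also gives symmetry, since `Xᵀ` is a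
  -- solution too.
  obtain ⟨X, hX⟩ := LinearMap.injective_iff_surjective.1 hinj (-N)
  have hXt : T Xᵀ = -N := by
    have := congrArg transpose hX
    rw [hT, transpose_add, transpose_mul, transpose_mul, transpose_transpose, transpose_neg,
      hN] at this
    rw [hT, ← this, add_comm]
  refine ⟨X, hinj (hXt.trans hX.symm), ?_⟩
  rw [← hT, hX, neg_add_cancel]

end IsStableMatrix

/-! ### Complex modes in real form -/

theorem IsObservablePair.eq_zero_of_oscillation {n k : ℕ} {C : Matrix (Fin k) (Fin n) ℝ}
    {A : Matrix (Fin n) (Fin n) ℝ} (h : IsObservablePair C A) {a b : ℝ} {x y : Fin n → ℝ}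
    (hx : A *ᵥ x = a • x - b • y) (hy : A *ᵥ y = b • x + a • y)
    (hCx : C *ᵥ x = 0) (hCy : C *ᵥ y = 0) : x = 0 := by
  -- This trajectory is the real part of `exp((a + ib)t) (x + iy)`.
  have h0 := h (fun t => (Real.exp (a * t) * Real.cos (b * t)) • x
    - (Real.exp (a * t) * Real.sin (b * t)) • y) ?_ ?_
  · simpa using h0
  · intro t _
    refine HasDerivAt.hasDerivWithinAt ?_
    have he : HasDerivAt (fun t => Real.exp (a * t)) (Real.exp (a * t) * a) t := by
      simpa using ((hasDerivAt_id t).const_mul a).exp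
    have hc : HasDerivAt (fun t => Real.cos (b * t)) (-Real.sin (b * t) * b) t := by
      simpa using ((hasDerivAt_id t).const_mul b).cos
    have hs : HasDerivAt (fun t => Real.sin (b * t)) (Real.cos (b * t) * b) t := by
      simpa using ((hasDerivAt_id t).const_mul b).sin
    convert ((he.mul hc).smul_const x).sub ((he.mul hs).smul_const y) using 1
    · rfl
    · rw [mulVec_sub, mulVec_smul, mulVec_smul, hx, hy]
      module
  · intro t _
    rw [mulVec_sub, mulVec_smul, mulVec_smul, hCx, hCy]
    simp

/-- Real and imaginary parts of an eigenvector. -/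
theorem exists_real_eigenpair {n : ℕ} {A : Matrix (Fin n) (Fin n) ℝ} {μ : ℂ}
    (hμ : μ ∈ spectrum ℂ (A.map ((↑) : ℝ → ℂ))) :
    ∃ x y : Fin n → ℝ, (x ≠ 0 ∨ y ≠ 0) ∧ A *ᵥ x = μ.re • x - μ.im • y ∧
      A *ᵥ y = μ.im • x + μ.re • y := by
  rw [spectrum.mem_iff, isUnit_iff_isUnit_det, isUnit_iff_ne_zero, not_not,
    ← exists_mulVec_eq_zero_iff] at hμ
  obtain ⟨v, hv, h⟩ := hμ
  rw [sub_mulVec, Algebra.algebraMap_eq_smul_one, smul_mulVec, one_mulVec, sub_eq_zero] at h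
  refine ⟨fun i => (v i).re, fun i => (v i).im, ?_, ?_, ?_⟩
  · by_contra! hxy
    exact hv (funext fun i => Complex.ext (congrFun hxy.1 i) (congrFun hxy.2 i))
  · funext i
    simpa [mulVec, dotProduct] using (congrArg Complex.re (congrFun h i)).symm
  · funext i
    have := congrArg Complex.im (congrFun h i)
    simp [mulVec, dotProduct] at this ⊢
    linarith
-- The observability equation and the domain of the norm
namespace LTISystem

variable {n m k : ℕ} {S : LTISystem n m k} {α : ℝ} {Q : Matrix (Fin n) (Fin n) ℝ}

/-- Shifting by `α / 2` absorbs the term `α Q`, so the observability equation becomes a plain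
Lyapunov equation (`lyapunov_shift`). -/
theorem EpsDomain.isStableMatrix_add (h : S.EpsDomain α) :
    IsStableMatrix (S.A + (α / 2) • (1 : Matrix (Fin n) (Fin n) ℝ)) := by
  intro μ hμ
  have e : (S.A + (α / 2) • (1 : Matrix (Fin n) (Fin n) ℝ)).map ((↑) : ℝ → ℂ)
      = S.A.map ((↑) : ℝ → ℂ) + algebraMap ℂ _ ((α / 2 : ℝ) : ℂ) := by
    ext i j
    by_cases hij : i = j <;> simp [Algebra.algebraMap_eq_smul_one, hij, one_apply]
  rw [e, spectrum.mem_iff] at hμ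
  have := h.2 (μ - ((α / 2 : ℝ) : ℂ)) (by
    rw [spectrum.mem_iff, map_sub]
    rwa [sub_add_eq_sub_sub_swap] at hμ)
  rw [Complex.sub_re, Complex.ofReal_re] at this
  linarith

theorem lyapunov_shift (A X : Matrix (Fin n) (Fin n) ℝ) (α : ℝ) :
    X * (A + (α / 2) • 1) + (A + (α / 2) • 1)ᵀ * X = X * A + Aᵀ * X + α • X := by
  simp only [transpose_add, transpose_smul, transpose_one, mul_add, add_mul, mul_smul_comm,
    smul_mul_assoc, mul_one, one_mul]
  module

theorem EpsDomain.obsEq_unique (h : S.EpsDomain α) {Q' : Matrix (Fin n) (Fin n) ℝ}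
    (hQ : S.ObsEq α Q) (hQ' : S.ObsEq α Q') : Q = Q' := by
  refine sub_eq_zero.1 (h.isStableMatrix_add.eq_zero_of_lyapunov ?_)
  rw [lyapunov_shift]
  have := sub_eq_zero.2 (hQ.trans hQ'.symm)
  rw [← this, sub_mul, mul_sub, smul_sub]
  abel

theorem EpsDomain.obsSolution_eq (h : S.EpsDomain α) (hpos : Q.PosDef) (hQ : S.ObsEq α Q) :
    S.obsSolution α = Q := by
  have hex : ∃ Q : Matrix (Fin n) (Fin n) ℝ, Q.PosDef ∧ S.ObsEq α Q := ⟨Q, hpos, hQ⟩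
  rw [obsSolution, dif_pos hex]
  exact h.obsEq_unique hex.choose_spec.2 hQ

theorem EpsDomain.exists_obsEq (h : S.EpsDomain α) :
    ∃ Q : Matrix (Fin n) (Fin n) ℝ, Qᵀ = Q ∧ S.ObsEq α Q := by
  obtain ⟨X, hX, hX'⟩ := h.isStableMatrix_add.exists_lyapunov_solution
    (N := α⁻¹ • (S.Cᵀ * S.C)) (by simp [transpose_mul])
  rw [lyapunov_shift] at hX'
  exact ⟨X, hX, hX'⟩

theorem EpsDomain.isStable (h : S.EpsDomain α) : S.IsStable := fun μ hμ => by
  linarith [h.1, h.2 μ hμ]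

/-- The domain of the `ε(α)`-norm contains `α` as soon as the observability equation has a positive
definite solution and the system is observable. -/
theorem epsDomain_of_obsEq (hα : 0 < α) (hpos : Q.PosDef) (hQ : S.ObsEq α Q)
    (hobs : ∀ (a b : ℝ) (x y : Fin n → ℝ), S.A *ᵥ x = a • x - b • y →
      S.A *ᵥ y = b • x + a • y → S.C *ᵥ x = 0 → S.C *ᵥ y = 0 → x = 0) :
    S.EpsDomain α := by
  refine ⟨hα, fun μ hμ => ?_⟩
  by_contra! hle
  obtain ⟨x, y, hxy, hx, hy⟩ := exists_real_eigenpair hμ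
  have hsymm : Qᵀ = Q := hpos.1
  have hform : ∀ z : Fin n → ℝ, 2 * (z ⬝ᵥ Q *ᵥ (S.A *ᵥ z)) + α * (z ⬝ᵥ Q *ᵥ z)
      + α⁻¹ * ((S.C *ᵥ z) ⬝ᵥ (S.C *ᵥ z)) = 0 := by
    intro z
    have h := congrArg (fun Z => z ⬝ᵥ Z *ᵥ z) hQ
    simp only [add_mulVec, smul_mulVec, dotProduct_add, dotProduct_smul, smul_eq_mul,
      ← mulVec_mulVec, zero_mulVec, dotProduct_zero] at h
    have e1 : z ⬝ᵥ S.Aᵀ *ᵥ (Q *ᵥ z) = z ⬝ᵥ Q *ᵥ (S.A *ᵥ z) := by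
      rw [dotProduct_mulVec, vecMul_transpose, dotProduct_mulVec, ← mulVec_transpose, hsymm,
        dotProduct_comm]
    have e2 : z ⬝ᵥ S.Cᵀ *ᵥ (S.C *ᵥ z) = (S.C *ᵥ z) ⬝ᵥ (S.C *ᵥ z) := by
      rw [dotProduct_mulVec, vecMul_transpose]
    rw [e1, e2] at h
    linarith
  have hcross : y ⬝ᵥ Q *ᵥ x = x ⬝ᵥ Q *ᵥ y := by
    rw [dotProduct_mulVec, ← mulVec_transpose, hsymm, dotProduct_comm]
  have hnn : ∀ z : Fin n → ℝ, 0 ≤ z ⬝ᵥ Q *ᵥ z := fun z => by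
    simpa using hpos.posSemidef.dotProduct_mulVec_nonneg z
  have hCnn : ∀ z : Fin n → ℝ, 0 ≤ (S.C *ᵥ z) ⬝ᵥ (S.C *ᵥ z) := fun z => by
    simpa using dotProduct_star_self_nonneg (S.C *ᵥ z)
  -- Adding the identities at `x` and `y` cancels the terms in `μ.im`, leaving the factor `2 μ.re +
  -- α ≥ 0` on the form of `Q`.
  have hsum : α⁻¹ * ((S.C *ᵥ x) ⬝ᵥ (S.C *ᵥ x) + (S.C *ᵥ y) ⬝ᵥ (S.C *ᵥ y)) ≤ 0 := by
    have h1 := hform x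
    have h2 := hform y
    generalize S.C *ᵥ x = u at h1 ⊢
    generalize S.C *ᵥ y = w at h2 ⊢
    rw [hx, mulVec_sub, mulVec_smul, mulVec_smul, dotProduct_sub, dotProduct_smul, dotProduct_smul,
      smul_eq_mul, smul_eq_mul] at h1
    rw [hy, mulVec_add, mulVec_smul, mulVec_smul, dotProduct_add, dotProduct_smul, dotProduct_smul,
      smul_eq_mul, smul_eq_mul, hcross] at h2
    have h3 := mul_nonneg (sub_nonneg.2 hle) (add_nonneg (hnn x) (hnn y))
    linarith
  have hsum' : (S.C *ᵥ x) ⬝ᵥ (S.C *ᵥ x) + (S.C *ᵥ y) ⬝ᵥ (S.C *ᵥ y) ≤ 0 :=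
    nonpos_of_mul_nonpos_right hsum (inv_pos.2 hα)
  have hCx : S.C *ᵥ x = 0 := dotProduct_self_eq_zero.1 (by linarith [hCnn x, hCnn y])
  have hCy : S.C *ᵥ y = 0 := dotProduct_self_eq_zero.1 (by linarith [hCnn x, hCnn y])
  have hx0 : x = 0 := hobs _ _ x y hx hy hCx hCy
  -- The pair `(y, -x)` represents the eigenvector `-i (x + iy)`.
  have hy0 : y = 0 := hobs μ.re μ.im y (-x) (by rw [hy]; module)
    (by rw [mulVec_neg, hx]; module) hCy (by rw [mulVec_neg, hCx, neg_zero])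
  exact hxy.elim (· hx0) (· hy0)

end LTISystem

/-! ### Completion of squares and comparison of gains -/

namespace ControlPlant

variable {n m l k : ℕ} {S : ControlPlant n m l k} {α : ℝ} {Q : Matrix (Fin n) (Fin n) ℝ}

theorem closedLoop_output_gram (hCD : S.Cᵀ * S.D = 0) (K : Matrix (Fin m) (Fin n) ℝ) :
    (S.closedLoop K).Cᵀ * (S.closedLoop K).C = S.Cᵀ * S.C + Kᵀ * (S.Dᵀ * S.D) * K := by
  have hDC : S.Dᵀ * S.C = 0 := by
    have := congrArg transpose hCD
    rwa [transpose_mul, transpose_transpose, transpose_zero] at this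
  simp only [closedLoop, transpose_add, transpose_mul, Matrix.add_mul, Matrix.mul_add]
  rw [Matrix.mul_assoc Kᵀ S.Dᵀ S.C, hDC, ← Matrix.mul_assoc S.Cᵀ, hCD]
  simp only [Matrix.mul_assoc, Matrix.zero_mul, Matrix.mul_zero, add_zero, zero_add]

/-- Completion of squares: the observability residual of a Riccati solution in an arbitrary closed
loop. -/
theorem RiccatiEq.closedLoop_residual (hric : S.RiccatiEq α Q) (hα : α ≠ 0) (hsymm : Qᵀ = Q)
    (hCD : S.Cᵀ * S.D = 0) (hD : IsUnit (S.Dᵀ * S.D)) (K : Matrix (Fin m) (Fin n) ℝ) :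
    Q * (S.closedLoop K).A + (S.closedLoop K).Aᵀ * Q + α • Q
        + α⁻¹ • ((S.closedLoop K).Cᵀ * (S.closedLoop K).C)
      = α⁻¹ • ((S.D * (K - S.riccatiGain α Q))ᵀ * (S.D * (K - S.riccatiGain α Q))) := by
  rw [closedLoop_output_gram hCD]
  set R := S.Dᵀ * S.D with hR
  set G := S.riccatiGain α Q with hG
  have hRt : Rᵀ = R := by rw [hR, transpose_mul, transpose_transpose]
  have hRG : R * G = -(α • (S.Bᵀ * Q)) := by
    rw [hG, riccatiGain, ← hR, Matrix.mul_neg, Matrix.mul_smul, Matrix.mul_assoc R⁻¹,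
      mul_nonsing_inv_cancel_left _ _ ((isUnit_iff_isUnit_det _).1 hD)]
  have hGR : Gᵀ * R = -(α • (Q * S.B)) := by
    have := congrArg transpose hRG
    rwa [transpose_mul, hRt, transpose_neg, transpose_smul, transpose_mul, transpose_transpose,
      hsymm] at this
  have hGRG : Gᵀ * R * G = (α * α) • (Q * S.B * R⁻¹ * S.Bᵀ * Q) := by
    rw [hGR, hG, riccatiGain, ← hR]
    simp only [Matrix.neg_mul, Matrix.mul_neg, smul_neg, neg_neg, Matrix.smul_mul, Matrix.mul_smul, smul_smul, Matrix.mul_assoc]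
  have hsq : (S.D * (K - G))ᵀ * (S.D * (K - G))
      = Kᵀ * R * K + α • (Kᵀ * (S.Bᵀ * Q)) + α • (Q * S.B * K)
        + (α * α) • (Q * S.B * R⁻¹ * S.Bᵀ * Q) := by
    calc (S.D * (K - G))ᵀ * (S.D * (K - G)) = (K - G)ᵀ * R * (K - G) := by
          rw [transpose_mul, hR]; simp only [Matrix.mul_assoc]
      _ = Kᵀ * R * K - Kᵀ * (R * G) - Gᵀ * R * K + Gᵀ * R * G := by
          rw [transpose_sub]; simp only [Matrix.sub_mul, Matrix.mul_sub, Matrix.mul_assoc]; abel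
      _ = _ := by
          rw [hGRG, hGR, hRG]
          simp only [Matrix.mul_neg, Matrix.neg_mul, Matrix.mul_smul, Matrix.smul_mul]
          abel
  have hric' : Q * S.A + S.Aᵀ * Q + α • Q + α⁻¹ • (S.Cᵀ * S.C)
      = α • (Q * S.B * R⁻¹ * S.Bᵀ * Q) := by
    have h : _ = _ := hric
    rw [← sub_eq_zero, ← h]
    abel
  rw [hsq]
  simp only [smul_add, smul_smul, inv_mul_cancel₀ hα, inv_mul_cancel_left₀ hα, one_smul]
  rw [← hric']
  simp only [closedLoop, Matrix.mul_add, Matrix.add_mul, transpose_add, transpose_mul, Matrix.mul_assoc]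
  abel

theorem RiccatiEq.obsEq (hric : S.RiccatiEq α Q) (hα : α ≠ 0) (hsymm : Qᵀ = Q)
    (hCD : S.Cᵀ * S.D = 0) (hD : IsUnit (S.Dᵀ * S.D)) :
    (S.closedLoop (S.riccatiGain α Q)).ObsEq α Q := by
  have h := hric.closedLoop_residual hα hsymm hCD hD (S.riccatiGain α Q)
  rwa [sub_self, Matrix.mul_zero, Matrix.mul_zero, smul_zero] at h

/-- State feedback without a direct cross term preserves observability of every mode. -/
theorem closedLoop_eq_zero_of_oscillation (hobs : IsObservablePair S.C S.A)
    (hCD : S.Cᵀ * S.D = 0) (hD : IsUnit (S.Dᵀ * S.D)) (K : Matrix (Fin m) (Fin n) ℝ)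
    {a b : ℝ} {x y : Fin n → ℝ} (hx : (S.closedLoop K).A *ᵥ x = a • x - b • y)
    (hy : (S.closedLoop K).A *ᵥ y = b • x + a • y)
    (hCx : (S.closedLoop K).C *ᵥ x = 0) (hCy : (S.closedLoop K).C *ᵥ y = 0) : x = 0 := by
  have hsplit : ∀ z, (S.closedLoop K).C *ᵥ z = 0 → S.C *ᵥ z = 0 ∧ K *ᵥ z = 0 := by
    intro z hz
    have hz' : S.C *ᵥ z + S.D *ᵥ (K *ᵥ z) = 0 := by
      simpa [closedLoop, add_mulVec] using hz
    -- Applying `Dᵀ` removes the `C` part and leaves `Dᵀ D K z = 0`; with zero feedback the mode is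
    -- one of the open loop.
    have hK : K *ᵥ z = 0 := by
      have h := congrArg (fun v => (S.Dᵀ) *ᵥ v) hz'
      have hDC : S.Dᵀ * S.C = 0 := by
        have := congrArg transpose hCD
        rwa [transpose_mul, transpose_transpose, transpose_zero] at this
      rw [mulVec_add, mulVec_mulVec, mulVec_mulVec, hDC, zero_mulVec, zero_add, mulVec_zero] at h
      have h2 := congrArg (fun v => (S.Dᵀ * S.D)⁻¹ *ᵥ v) h
      rwa [mulVec_mulVec, nonsing_inv_mul _ ((isUnit_iff_isUnit_det _).1 hD), one_mulVec,
        mulVec_zero] at h2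
    rw [hK, mulVec_zero, add_zero] at hz'
    exact ⟨hz', hK⟩
  obtain ⟨hx1, hx2⟩ := hsplit x hCx
  obtain ⟨hy1, hy2⟩ := hsplit y hCy
  refine hobs.eq_zero_of_oscillation (a := a) (b := b) (y := y) ?_ ?_ hx1 hy1
  · rw [← hx, closedLoop, add_mulVec, ← mulVec_mulVec, hx2, mulVec_zero, add_zero]
  · rw [← hy, closedLoop, add_mulVec, ← mulVec_mulVec, hy2, mulVec_zero, add_zero]

/-- A Riccati solution is a lower bound for the observability solutions of all closed loops. -/
theorem RiccatiEq.posSemidef_sub (hric : S.RiccatiEq α Q) (hsymm : Qᵀ = Q)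
    (hCD : S.Cᵀ * S.D = 0) (hD : IsUnit (S.Dᵀ * S.D)) {K : Matrix (Fin m) (Fin n) ℝ}
    (hdom : (S.closedLoop K).EpsDomain α) {X : Matrix (Fin n) (Fin n) ℝ} (hXsymm : Xᵀ = X)
    (hX : (S.closedLoop K).ObsEq α X) : (X - Q).PosSemidef := by
  have hα := hdom.1
  have hres := hric.closedLoop_residual hα.ne' hsymm hCD hD K
  set L := S.D * (K - S.riccatiGain α Q)
  refine .of_dotProduct_mulVec_nonneg (by simp [IsHermitian, hXsymm, hsymm]) fun x => ?_
  rw [star_trivial]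
  refine hdom.isStableMatrix_add.dotProduct_mulVec_nonneg_of_lyapunov (N := α⁻¹ • (Lᵀ * L))
    (fun z => ?_) ?_ x
  · rw [smul_mulVec, dotProduct_smul, ← mulVec_mulVec, dotProduct_mulVec, vecMul_transpose]
    have : 0 ≤ (L *ᵥ z) ⬝ᵥ (L *ᵥ z) := by simpa using dotProduct_star_self_nonneg (L *ᵥ z)
    exact mul_nonneg (inv_pos.2 hα).le this
  · rw [LTISystem.lyapunov_shift, ← hres, ← show _ = _ from hX, Matrix.sub_mul, Matrix.mul_sub, smul_sub]
    abel

end ControlPlant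

theorem mainTheorem2 {n m l k : ℕ} (S : ControlPlant n m l k)
    (hstab : IsStabilizable S.A S.B) (hobs : IsObservablePair S.C S.A)
    (hCD : S.Cᵀ * S.D = 0) (hD : IsUnit (S.Dᵀ * S.D))
    (α : ℝ) (hα : 0 < α)
    (Q : Matrix (Fin n) (Fin n) ℝ) (hQ : Q.PosDef) (hric : S.RiccatiEq α Q) :
    (S.closedLoop (S.riccatiGain α Q)).IsStable ∧
    (S.closedLoop (S.riccatiGain α Q)).EpsDomain α ∧
    (S.closedLoop (S.riccatiGain α Q)).epsNorm α = √(trace (S.Bwᵀ * Q * S.Bw)) ∧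
    ∀ K : Matrix (Fin m) (Fin n) ℝ,
      (S.closedLoop K).IsStable → (S.closedLoop K).EpsDomain α →
        (S.closedLoop (S.riccatiGain α Q)).epsNorm α ≤ (S.closedLoop K).epsNorm α := by
  have hsymm : Qᵀ = Q := hQ.1
  have hobsEq := hric.obsEq hα.ne' hsymm hCD hD
  have hdom : (S.closedLoop (S.riccatiGain α Q)).EpsDomain α :=
    LTISystem.epsDomain_of_obsEq hα hQ hobsEq fun _ _ _ _ hx hy hCx hCy =>
      ControlPlant.closedLoop_eq_zero_of_oscillation hobs hCD hD _ hx hy hCx hCy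
  have hnorm : (S.closedLoop (S.riccatiGain α Q)).epsNorm α = √(trace (S.Bwᵀ * Q * S.Bw)) := by
    rw [LTISystem.epsNorm, hdom.obsSolution_eq hQ hobsEq]
    rfl
  refine ⟨hdom.isStable, hdom, hnorm, fun K _ hK => ?_⟩
  obtain ⟨X, hXsymm, hX⟩ := hK.exists_obsEq
  have hle := hric.posSemidef_sub hsymm hCD hD hK hXsymm hX
  -- Since `X = Q + (X - Q)` is positive definite, `obsSolution` is `X` and not the default `0`.
  have hXpos : X.PosDef := by simpa using hQ.add_posSemidef hle
  rw [hnorm, LTISystem.epsNorm, hK.obsSolution_eq hXpos hX]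
  refine Real.sqrt_le_sqrt (sub_nonneg.1 ?_)
  have h := (hle.conjTranspose_mul_mul_same S.Bw).trace_nonneg
  rwa [conjTranspose_eq_transpose_of_trivial, Matrix.mul_sub, Matrix.sub_mul, trace_sub] at h
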